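/- A loopless mixed graph has arrows ($i\to j$), arcs ($i\leftrightarrow j$) and lines ($i - j$) as edges, and no loops; all graphs here are finite, and two nodes are adjacent if they are the endpoints of an edge of any type. Write $\mathrm{pa}(j)$, $\mathrm{sp}(j)$, $\mathrm{ne}(j)$ for the sets of nodes $i$ with $i\to j$, $i\leftrightarrow j$, $i - j$ respectively, $\mathrm{an}(j)$ for the set of nodes from which a direction-preserving path of arrows leads to $j$, and $\mathrm{pa}(A)=\bigcup_{j\in A}\mathrm{pa}(j)$, $\mathrm{an}(A)=\bigcup_{j\in A}\mathrm{an}(j)$. A graph is ancestral if, for every node $i$, $i\notin \mathrm{an}(\mathrm{pa}(i)\cup\mathrm{sp}(i))$, and $\mathrm{pa}(i)\cup\mathrm{sp}(i)=\varnothing$ whenever $\mathrm{ne}(i)\neq\varnothing$. An inner node of a path is a collider if both path edges at it have an arrowhead at it. A path is $m$-connecting given $C$ if all its collider nodes are in $C\cup\mathrm{an}(C)$ and all its non-collider inner nodes are outside $C$; for pairwise disjoint $A,B,C$, $A$ and $B$ are $m$-separated given $C$ if there is no $m$-connecting path given $C$ between a node of $A$ and a node of $B$. Two graphs on the same node set are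 Markov equivalent if they have the same $m$-separations. A maximal ancestral graph (MAG) is an ancestral graph in which every two distinct non-adjacent nodes $i,j$ are $m$-separated given some set $C$ with $i,j\notin C$. A directed acyclic graph (DAG) has only arrows and no direction-preserving cycle. Corollary. Let $H$ be a MAG that is Markov equivalent to a DAG, and let $H[\leftrightarrow]$ be the subgraph of $H$ induced by its arcs, i.e. its edges are the arcs of $H$ and its nodes are the endpoints of arcs. Then for the node set $V$ of every connected component of $H[\leftrightarrow]$ there is a node of $V\cup\mathrm{pa}(V)$ that is adjacent in $H$ to all other nodes of $V\cup\mathrm{pa}(V)$. In particular, if $H[\leftrightarrow]$ is connected (and non-empty) with node set $V$, then some node of $V\cup\mathrm{pa}(V)$ is adjacent to all other nodes of $V\cup\mathrm{pa}(V)$. -/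

import Mathlib

/-- A loopless mixed graph with node set `V`: arrows `i → j`, arcs `i ↔ j` and lines `i — j`, with
no loops.  Edges of different types (or opposite arrows) between the same two nodes are allowed. -/
structure LMG (V : Type*) where
  arrow : V → V → Prop
  arc : V → V → Prop
  line : V → V → Prop
  arrow_irrefl : ∀ i, ¬ arrow i i
  arc_irrefl : ∀ i, ¬ arc i i
  line_irrefl : ∀ i, ¬ line i i
  arc_symm : ∀ i j, arc i j → arc j i
  line_symm : ∀ i j, line i j → line j i

/-- The four ways in which an edge can be traversed from a node `i` to a node `j`:
`i → j`, `i ← j`, `i ↔ j`, `i — j`. -/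
inductive LMG.Step
  | forward
  | backward
  | arc
  | line

/-- The traversed edge has an arrowhead at the node where the traversal starts. -/
def LMG.Step.HeadAtStart : LMG.Step → Prop
  | .forward => False
  | .backward => True
  | .arc => True
  | .line => False

/-- The traversed edge has an arrowhead at the node where the traversal ends. -/
def LMG.Step.HeadAtEnd : LMG.Step → Prop
  | .forward => True
  | .backward => False
  | .arc => True
  | .line => False

namespace LMG

variable {V : Type*}

/-- There is an edge of `G` that can be traversed from `i` to `j` in the way `s`. -/
def HasStep (G : LMG V) : Step → V → V → Prop
  | .forward, i, j => G.arrow i j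
  | .backward, i, j => G.arrow j i
  | .arc, i, j => G.arc i j
  | .line, i, j => G.line i j

/-- Two nodes are adjacent when they are the endpoints of some edge. -/
def Adj (G : LMG V) (i j : V) : Prop :=
  G.arrow i j ∨ G.arrow j i ∨ G.arc i j ∨ G.line i j

/-- Parents of a node. -/
def pa (G : LMG V) (j : V) : Set V := {i | G.arrow i j}

/-- Spouses of a node. -/
def spo (G : LMG V) (j : V) : Set V := {i | G.arc i j}

/-- Neighbours of a node. -/
def nei (G : LMG V) (j : V) : Set V := {i | G.line i j}

/-- Ancestors of a node: the nodes with a direction-preserving path (of at least one arrow)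
to it. -/
def an (G : LMG V) (i : V) : Set V := {j | Relation.TransGen G.arrow j i}

/-- Parents of a set of nodes. -/
def paSet (G : LMG V) (A : Set V) : Set V := ⋃ i ∈ A, G.pa i

/-- Ancestors of a set of nodes. -/
def anSet (G : LMG V) (A : Set V) : Set V := ⋃ i ∈ A, G.an i

/-- Walks, as alternating lists of nodes and edges. -/
inductive Walk (G : LMG V) : V → V → Type _
  | nil (i : V) : Walk G i i
  | cons {i j k : V} (s : Step) (h : G.HasStep s i j) (p : Walk G j k) : Walk G i k

/-- The nodes of a walk, in order. -/
def Walk.support {G : LMG V} : {i k : V} → G.Walk i k → List V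
  | _, _, .nil i => [i]
  | i, _, .cons _ _ p => i :: p.support

/-- A path is a walk without repeated nodes (hence without repeated edges). -/
def Walk.IsPath {G : LMG V} {i k : V} (p : G.Walk i k) : Prop := p.support.Nodup

/-- The inner nodes of a walk, each with the edge before it and the edge after it. -/
def Walk.inner {G : LMG V} : {i k : V} → G.Walk i k → List (Step × V × Step)
  | _, _, .nil _ => []
  | _, _, .cons _ _ (.nil _) => []
  | _, _, .cons s _ (.cons (i := j) s' h' p) => (s, j, s') :: (Walk.cons s' h' p).inner

/-- An inner node is a collider when both the edge before it and the edge after it have an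
arrowhead at it. -/
def IsCollider (t : Step × V × Step) : Prop := t.1.HeadAtEnd ∧ t.2.2.HeadAtStart

/-- A path is `m`-connecting given `C` if all its collider nodes are in `C ∪ an(C)` and all its
non-collider inner nodes are outside `C`. -/
def Walk.MConnecting {G : LMG V} {i k : V} (p : G.Walk i k) (C : Set V) : Prop :=
  p.IsPath ∧ ∀ t ∈ p.inner,
    (IsCollider t → t.2.1 ∈ C ∪ G.anSet C) ∧ (¬ IsCollider t → t.2.1 ∉ C)

/-- `m`-separation of `A` and `B` given `C` (used for pairwise disjoint `A`, `B`, `C`). -/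
def MSep (G : LMG V) (A B C : Set V) : Prop :=
  ∀ a ∈ A, ∀ b ∈ B, ∀ p : G.Walk a b, ¬ p.MConnecting C

/-- Two graphs with the same node set are Markov equivalent when they have the same
`m`-separations. -/
def MarkovEquivalent (G₁ G₂ : LMG V) : Prop :=
  ∀ A B C : Set V, Disjoint A B → Disjoint A C → Disjoint B C →
    (G₁.MSep A B C ↔ G₂.MSep A B C)

/-- Ancestral graphs. -/
def IsAncestral (G : LMG V) : Prop :=
  ∀ i, i ∉ G.anSet (G.pa i ∪ G.spo i) ∧ ((G.nei i).Nonempty → G.pa i ∪ G.spo i = ∅)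

/-- Maximal graphs: any two distinct non-adjacent nodes can be `m`-separated. -/
def IsMaximal (G : LMG V) : Prop :=
  ∀ i j, i ≠ j → ¬ G.Adj i j → ∃ C : Set V, i ∉ C ∧ j ∉ C ∧ G.MSep {i} {j} C

/-- Maximal ancestral graphs. -/
def IsMAG (G : LMG V) : Prop := G.IsAncestral ∧ G.IsMaximal

/-- Directed acyclic graphs: all edges are arrows, and there is no direction-preserving cycle. -/
def IsDAG (G : LMG V) : Prop :=
  (∀ i j, ¬ G.arc i j) ∧ (∀ i j, ¬ G.line i j) ∧ ∀ i, i ∉ G.an i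

/-- The nodes that are endpoints of arcs. -/
def arcNodes (G : LMG V) : Set V := {i | ∃ j, G.arc i j}

/-- The subgraph induced by the arcs: its nodes are the endpoints of arcs and its edges are the
arcs. -/
def arcSubgraph (G : LMG V) : LMG G.arcNodes where
  arrow _ _ := False
  arc i j := G.arc i j
  line _ _ := False
  arrow_irrefl _ h := h
  arc_irrefl i := G.arc_irrefl i
  line_irrefl _ h := h
  arc_symm i j := G.arc_symm i j
  line_symm _ _ h := h

/-- The adjacency relation of a loopless mixed graph as a simple graph. -/
def skeleton (G : LMG V) : SimpleGraph V where
  Adj := G.Adj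
  symm := ⟨by
    rintro i j (h | h | h | h)
    · exact Or.inr (Or.inl h)
    · exact Or.inl h
    · exact Or.inr (Or.inr (Or.inl (G.arc_symm _ _ h)))
    · exact Or.inr (Or.inr (Or.inr (G.line_symm _ _ h)))⟩
  loopless := ⟨by
    rintro i (h | h | h | h)
    · exact G.arrow_irrefl i h
    · exact G.arrow_irrefl i h
    · exact G.arc_irrefl i h
    · exact G.line_irrefl i h⟩

/-- Some node of `W` is adjacent to all other nodes of `W`. -/
def HasUniversalNode (G : LMG V) (W : Set V) : Prop :=
  ∃ u ∈ W, ∀ w ∈ W, w ≠ u → G.Adj u w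

end LMG

namespace LMG

variable {V : Type*}

/-! Let `T` be a component of the arcs of `H`, `W = T ∪ pa(T)`, and `G` a Markov equivalent DAG. A
node `u` of `W` with no proper `G`-descendant in `W` is adjacent in `H` to all the rest. Suppose `w
∈ W` is not. Maximality separates `u` from `w` in `H`, hence in `G`, so they are not adjacent in `G`
either. In the `G`-ancestral closure `A` of `W`, `u` is still a sink, so `A \ {u, w}` separates `u`
from `w` in `G` (`IsDAG.mSep_of_sink`), hence in `H`. But walking along arcs gives a path from `u`
to `w` in `H` whose inner nodes are all colliders in `T ⊆ A` (`exists_colliderPath`), and this path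
is connecting: a contradiction. -/

/-- The first edge of the walk, if there is one, has an arrowhead at the start of the walk. -/
def Walk.StartsHead {G : LMG V} : {i k : V} → G.Walk i k → Prop
  -- If an edge is prepended to the trivial path, its node stays an endpoint, so no arrowhead is
  -- needed there.
  | _, _, .nil _ => True
  | _, _, .cons s _ _ => s.HeadAtStart

theorem Walk.end_mem_support {G : LMG V} {i k : V} (p : G.Walk i k) : k ∈ p.support := by
  induction p with
  | nil i => simp [Walk.support]
  | cons s h p ih => exact List.mem_cons_of_mem _ ih

theorem Walk.start_mem_support {G : LMG V} {i k : V} (p : G.Walk i k) : i ∈ p.support := by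
  cases p <;> simp [Walk.support]

theorem Walk.mem_inner_cons {G : LMG V} {i j k : V} {s : Step} {h : G.HasStep s i j}
    {q : G.Walk j k} {t : Step × V × Step} (ht : t ∈ q.inner) : t ∈ (Walk.cons s h q).inner := by
  cases q with
  | nil => simp [Walk.inner] at ht
  | cons s' h' q' => exact List.mem_cons_of_mem _ ht

/-- The inner nodes of a walk occur in its support after the start. -/
theorem Walk.inner_mem_support_tail {G : LMG V} {i k : V} (p : G.Walk i k) :
    ∀ t ∈ p.inner, t.2.1 ∈ p.support.tail := by
  induction p with
  | nil i => simp [Walk.inner]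
  | cons s h q ih =>
    intro t ht
    cases q with
    | nil => simp [Walk.inner] at ht
    | cons s' h' q' =>
      rw [Walk.inner, List.mem_cons] at ht
      rcases ht with rfl | ht
      · exact Walk.start_mem_support _
      · exact List.mem_of_mem_tail (ih t ht)

theorem Walk.IsPath.inner_ne_start {G : LMG V} {i k : V} {p : G.Walk i k} (hp : p.IsPath)
    {t : Step × V × Step} (ht : t ∈ p.inner) : t.2.1 ≠ i := by
  have hm := p.inner_mem_support_tail t ht
  cases p with
  | nil => simp [Walk.inner] at ht
  | cons s h q =>
    rintro rfl
    exact (List.nodup_cons.1 hp).1 hm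

theorem Walk.IsPath.inner_ne_end {G : LMG V} {i k : V} {p : G.Walk i k} (hp : p.IsPath) :
    ∀ t ∈ p.inner, t.2.1 ≠ k := by
  induction p with
  | nil i => simp [Walk.inner]
  | cons s h q ih =>
    intro t ht
    have hq : q.IsPath := (List.nodup_cons.1 hp).2
    cases q with
    | nil => simp [Walk.inner] at ht
    | cons s' h' q' =>
      rw [Walk.inner, List.mem_cons] at ht
      rcases ht with rfl | ht
      · rintro rfl
        exact (List.nodup_cons.1 hq).1 q'.end_mem_support
      · exact ih hq t ht

/-! ### Collider paths through an arc component -/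

/-- There is a path from `a` to `b` all of whose inner nodes are colliders in `T`, starting with
an arrowhead at `a`. -/
def HasHeadColliderPath (G : LMG V) (T : Set V) (a b : V) : Prop :=
  ∃ p : G.Walk a b, p.IsPath ∧ (∀ t ∈ p.inner, IsCollider t ∧ t.2.1 ∈ T) ∧ p.StartsHead

/-- Cut the path at `x`: an inner `x` is a collider, so the edge leaving it has an arrowhead at `x`.
-/
theorem Walk.hasHeadColliderPath_of_mem_support {G : LMG V} {T : Set V} {a b x : V}
    (p : G.Walk a b) (hp : p.IsPath) (hc : ∀ t ∈ p.inner, IsCollider t ∧ t.2.1 ∈ T)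
    (hs : p.StartsHead) (hx : x ∈ p.support) : G.HasHeadColliderPath T x b := by
  induction p with
  | nil i =>
    obtain rfl : x = i := by simpa [Walk.support] using hx
    exact ⟨.nil x, hp, hc, hs⟩
  | cons s h q ih =>
    rcases List.mem_cons.1 hx with rfl | hx
    · exact ⟨.cons s h q, hp, hc, hs⟩
    · refine ih (List.nodup_cons.1 hp).2 (fun t ht => hc t (Walk.mem_inner_cons ht)) ?_ hx
      cases q with
      | nil => trivial
      | cons s' h' q' => exact (hc _ (List.mem_cons_self ..)).1.2

/-- A collider path is extended at its start by an edge with an arrowhead there, up to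
shortening. -/
theorem HasHeadColliderPath.extend {G : LMG V} {T : Set V} {a c b : V} {s : Step}
    (hp : G.HasHeadColliderPath T c b) (h : G.HasStep s a c) (hs : s.HeadAtEnd) (hc : c ∈ T) :
    ∃ p : G.Walk a b, p.IsPath ∧ (∀ t ∈ p.inner, IsCollider t ∧ t.2.1 ∈ T) ∧
      (s.HeadAtStart → p.StartsHead) := by
  obtain ⟨p, hp, hcol, hst⟩ := hp
  by_cases ha : a ∈ p.support
  -- Prepending the edge would repeat `a`; the part of `p` from `a` onwards serves instead.
  · obtain ⟨q, h1, h2, h3⟩ := p.hasHeadColliderPath_of_mem_support hp hcol hst ha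
    exact ⟨q, h1, h2, fun _ => h3⟩
  · refine ⟨.cons s h p, List.nodup_cons.2 ⟨ha, hp⟩, fun t ht => ?_, id⟩
    cases p with
    | nil => simp [Walk.inner] at ht
    | cons s' h' q =>
      rw [Walk.inner, List.mem_cons] at ht
      rcases ht with rfl | ht
      · exact ⟨⟨hs, hst⟩, hc⟩
      · exact hcol t ht

theorem hasHeadColliderPath_of_reflTransGen {G : LMG V} {T : Set V} {x y b : V}
    (hT : ∀ i j, i ∈ T → G.arc i j → j ∈ T) (hy : G.HasHeadColliderPath T y b)
    (hxy : Relation.ReflTransGen G.arc x y) (hx : x ∈ T) : G.HasHeadColliderPath T x b := by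
  induction hxy using Relation.ReflTransGen.head_induction_on with
  | refl => exact hy
  | @head x z hxz _ ih =>
    have hz := hT _ _ hx hxz
    obtain ⟨p, h1, h2, h3⟩ := (ih hz).extend (s := .arc) hxz trivial hz
    exact ⟨p, h1, h2, h3 trivial⟩

/-- Any two nodes of `T ∪ pa(T)` are joined by a collider path with inner nodes in `T` when `T` is
a set of nodes closed under, and connected by, arcs. -/
theorem exists_colliderPath {G : LMG V} {T : Set V} (hT : ∀ i j, i ∈ T → G.arc i j → j ∈ T)
    (hconn : ∀ i ∈ T, ∀ j ∈ T, Relation.ReflTransGen G.arc i j) {a b : V}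
    (ha : a ∈ T ∪ G.paSet T) (hb : b ∈ T ∪ G.paSet T) :
    ∃ p : G.Walk a b, p.IsPath ∧ ∀ t ∈ p.inner, IsCollider t ∧ t.2.1 ∈ T := by
  have key : ∀ x ∈ T, G.HasHeadColliderPath T x b := by
    intro x hx
    rcases hb with hb | hb
    · exact hasHeadColliderPath_of_reflTransGen hT
        ⟨.nil b, by simp [Walk.IsPath, Walk.support], by simp [Walk.inner], trivial⟩
        (hconn x hx b hb) hx
    · simp only [paSet, Set.mem_iUnion] at hb
      obtain ⟨y, hy, hby : G.arrow b y⟩ := hb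
      have hne : y ≠ b := by
        rintro rfl
        exact G.arrow_irrefl _ hby
      exact hasHeadColliderPath_of_reflTransGen hT
        ⟨.cons .backward hby (.nil b), by simp [Walk.IsPath, Walk.support, hne],
          by simp [Walk.inner], trivial⟩ (hconn x hx y hy) hx
  rcases ha with ha | ha
  · obtain ⟨p, h1, h2, -⟩ := key a ha
    exact ⟨p, h1, h2⟩
  · simp only [paSet, Set.mem_iUnion] at ha
    obtain ⟨y, hy, hay : G.arrow a y⟩ := ha
    obtain ⟨p, h1, h2, -⟩ := (key y hy).extend (s := .forward) hay trivial hy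
    exact ⟨p, h1, h2⟩

/-! ### Separation in DAGs -/

theorem MSep.not_adj {G : LMG V} {a b : V} {C : Set V} (h : G.MSep {a} {b} C) (hab : a ≠ b) :
    ¬ G.Adj a b := by
  intro hadj
  have : ∃ s, G.HasStep s a b := by
    rcases hadj with h | h | h | h
    exacts [⟨.forward, h⟩, ⟨.backward, h⟩, ⟨.arc, h⟩, ⟨.line, h⟩]
  obtain ⟨s, hs⟩ := this
  exact h a rfl b rfl (.cons s hs (.nil b))
    ⟨by simp [Walk.IsPath, Walk.support, hab], by simp [Walk.inner]⟩

/-- In a DAG, a walk that enters the complement of an ancestral set `A` through an arrowhead cannot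
come back to `A` if all its colliders are in `A`. -/
theorem IsDAG.end_notMem_of_headAtEnd {G : LMG V} (hG : G.IsDAG) {A : Set V}
    (hA : ∀ i j, G.arrow i j → j ∈ A → i ∈ A) {x y : V} (q : G.Walk x y) :
    ∀ {u : V} {s : Step} (h : G.HasStep s u x), s.HeadAtEnd → x ∉ A →
      (∀ t ∈ (Walk.cons s h q).inner, IsCollider t → t.2.1 ∈ A) → y ∉ A := by
  induction q with
  | nil i => exact fun _ _ hx _ => hx
  | @cons i j k s' h' q ih =>
    intro u s h hs hx hcol
    -- A collider at `i` would lie in `A`, so the walk must leave `i` along an arrow, to a node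
    -- again outside `A`.
    have hns : ¬ s'.HeadAtStart := fun hh =>
      hx (hcol (s, i, s') (by simp [Walk.inner]) ⟨hs, hh⟩)
    cases s' with
    | forward =>
      exact ih h' trivial (fun hj => hx (hA _ _ h' hj))
        fun t ht => hcol t (Walk.mem_inner_cons ht)
    | backward => exact absurd trivial hns
    | arc => exact absurd trivial hns
    | line => exact absurd h' (hG.2.1 _ _)

/-- In a DAG, a sink `u` of an ancestral set `A` is separated by the rest of `A` from each node of
`A` not adjacent to it. -/
theorem IsDAG.mSep_of_sink {G : LMG V} (hG : G.IsDAG) {A : Set V}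
    (hA : ∀ i j, G.arrow i j → j ∈ A → i ∈ A) {u w : V} (hu : u ∈ A) (hw : w ∈ A)
    (hsink : ∀ j ∈ A, ¬ G.arrow u j) (huw : u ≠ w) (hadj : ¬ G.Adj u w) :
    G.MSep {u} {w} (A \ {u, w}) := by
  rintro _ rfl _ rfl p ⟨-, hp⟩
  cases p with
  | nil => exact huw rfl
  | @cons _ x _ s h q =>
    have hcol : ∀ t ∈ (Walk.cons s h q).inner, IsCollider t → t.2.1 ∈ A := by
      intro t ht htc
      rcases (hp t ht).1 htc with h1 | h1
      · exact h1.1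
      · simp only [anSet, Set.mem_iUnion] at h1
        obtain ⟨c, hc, htc : Relation.TransGen G.arrow _ _⟩ := h1
        have hcA := hc.1
        generalize t.2.1 = v at htc ⊢
        clear hc
        induction htc using Relation.TransGen.head_induction_on with
        | single h => exact hA _ _ h hcA
        | head h _ ih => exact hA _ _ h ih
    cases s with
    | forward =>
      exact hG.end_notMem_of_headAtEnd hA q h trivial (fun hx => hsink x hx h) hcol hw
    | backward =>
      cases q with
      | nil => exact hadj (Or.inr (Or.inl h))
      | cons s' h' q =>
        -- A parent `x` of `u` is a non-collider in `A \ {u, w}`, so it blocks the path.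
        refine (hp (.backward, x, s') (by simp [Walk.inner])).2 (fun hc => hc.1) ⟨hA _ _ h hu, ?_⟩
        rintro (rfl | rfl)
        · exact G.arrow_irrefl _ h
        · exact hadj (Or.inr (Or.inl h))
    | arc => exact hG.1 _ _ h
    | line => exact hG.2.1 _ _ h

/-- In a finite DAG, every non-empty set of nodes has a node without proper descendants in it. -/
theorem IsDAG.exists_sink [Finite V] {G : LMG V} (hG : G.IsDAG) {W : Set V} (hW : W.Nonempty) :
    ∃ u ∈ W, ∀ w ∈ W, ¬ Relation.TransGen G.arrow u w := by
  let r : V → V → Prop := fun a b => Relation.TransGen G.arrow b a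
  have : IsTrans V r := ⟨fun _ _ _ h1 h2 => Relation.TransGen.trans h2 h1⟩
  have : Std.Irrefl r := ⟨fun a h => hG.2.2 a h⟩
  have hwf : WellFounded r := Finite.wellFounded_of_trans_of_irrefl r
  obtain ⟨u, hu, h⟩ := hwf.has_min W hW
  exact ⟨u, hu, h⟩

/-! ### The universal node -/

theorem hasUniversalNode_of_arcConnected [Finite V] {H G : LMG V} (hH : H.IsMaximal)
    (hG : G.IsDAG) (hHG : H.MarkovEquivalent G) {T : Set V} (hne : T.Nonempty)
    (hT : ∀ i j, i ∈ T → H.arc i j → j ∈ T)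
    (hconn : ∀ i ∈ T, ∀ j ∈ T, Relation.ReflTransGen H.arc i j) :
    H.HasUniversalNode (T ∪ H.paSet T) := by
  obtain ⟨u, hu, hsink⟩ := hG.exists_sink (W := T ∪ H.paSet T) (hne.mono Set.subset_union_left)
  refine ⟨u, hu, fun w hw hwu => ?_⟩
  by_contra hadj
  have huw : u ≠ w := hwu.symm
  have hd : Disjoint ({u} : Set V) {w} := Set.disjoint_singleton.2 huw
  have hadjG : ¬ G.Adj u w := by
    obtain ⟨C, huC, hwC, hsep⟩ := hH u w huw hadj
    exact ((hHG {u} {w} C hd (Set.disjoint_singleton_left.2 huC)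
      (Set.disjoint_singleton_left.2 hwC)).1 hsep).not_adj huw
  let A : Set V := {i | ∃ j ∈ T ∪ H.paSet T, Relation.ReflTransGen G.arrow i j}
  have hWA : T ∪ H.paSet T ⊆ A := fun i hi => ⟨i, hi, .refl⟩
  have hsepG : G.MSep {u} {w} (A \ {u, w}) := by
    refine hG.mSep_of_sink ?_ (hWA hu) (hWA hw) ?_ huw hadjG
    · rintro i j hij ⟨k, hk, hjk⟩
      exact ⟨k, hk, .head hij hjk⟩
    · rintro j ⟨k, hk, hjk⟩ huj
      -- An arrow from `u` into `A` would continue to a proper descendant of `u` in `T ∪ pa(T)`.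
      exact hsink k hk (.head' huj hjk)
  have hsepH := (hHG {u} {w} (A \ {u, w}) hd (by simp) (by simp)).2 hsepG
  obtain ⟨p, hp, hcol⟩ := exists_colliderPath hT hconn hu hw
  refine hsepH u rfl w rfl p ⟨hp, fun t ht => ⟨fun _ => Or.inl ⟨?_, ?_⟩, fun h => ?_⟩⟩
  · exact hWA (Or.inl (hcol t ht).2)
  · rintro (h | h)
    · exact hp.inner_ne_start ht h
    · exact hp.inner_ne_end t ht h
  · exact absurd (hcol t ht).1 h

theorem arcSubgraph_adj_iff {H : LMG V} {x y : H.arcNodes} :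
    H.arcSubgraph.skeleton.Adj x y ↔ H.arc x y := by
  simp [skeleton, Adj, arcSubgraph]

theorem reflTransGen_arc_of_reachable {H : LMG V} {x y : H.arcNodes}
    (h : H.arcSubgraph.skeleton.Reachable x y) : Relation.ReflTransGen H.arc x y := by
  obtain ⟨p⟩ := h
  induction p with
  | nil => exact .refl
  | cons h _ ih => exact .head (arcSubgraph_adj_iff.1 h) ih

end LMG

theorem mainTheorem9 {V : Type*} [Finite V] (H : LMG V) (hH : H.IsMAG)
    (hDAG : ∃ G : LMG V, G.IsDAG ∧ H.MarkovEquivalent G) :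
    (∀ (K : H.arcSubgraph.skeleton.ConnectedComponent) (T : Set V),
      T = Subtype.val '' K.supp → H.HasUniversalNode (T ∪ H.paSet T)) ∧
    (H.arcSubgraph.skeleton.Connected →
      H.HasUniversalNode (H.arcNodes ∪ H.paSet H.arcNodes)) := by
  obtain ⟨G, hG, hHG⟩ := hDAG
  have main : ∀ (K : H.arcSubgraph.skeleton.ConnectedComponent) (T : Set V),
      T = Subtype.val '' K.supp → H.HasUniversalNode (T ∪ H.paSet T) := by
    rintro K _ rfl
    refine LMG.hasUniversalNode_of_arcConnected hH.2 hG hHG (K.nonempty_supp.image _) ?_ ?_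
    · rintro _ j ⟨x, hx, rfl⟩ hxj
      let y : H.arcNodes := ⟨j, x, H.arc_symm _ _ hxj⟩
      have hxy : H.arcSubgraph.skeleton.Adj x y := LMG.arcSubgraph_adj_iff.2 hxj
      exact ⟨y, (K.mem_supp_congr_adj hxy).1 hx, rfl⟩
    · rintro _ ⟨x, hx, rfl⟩ _ ⟨y, hy, rfl⟩
      exact LMG.reflTransGen_arc_of_reachable (K.reachable_of_mem_supp hx hy)
  refine ⟨main, fun hconn => ?_⟩
  obtain ⟨x⟩ := hconn.nonempty
  refine main (H.arcSubgraph.skeleton.connectedComponentMk x) _ ?_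
  ext i
  constructor
  · intro hi
    exact ⟨⟨i, hi⟩, SimpleGraph.ConnectedComponent.sound (hconn.preconnected _ _), rfl⟩
  · rintro ⟨y, -, rfl⟩
    exact y.2
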